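/- **Theorem.** Let $\mathcal C$ be a Cartesian closed category with all small limits and colimits, and let $(\mathcal M,\oplus,e)$ be a small symmetric monoidal category. Let $\overline{\mathcal M}=[\mathcal M^{\mathrm{op}},\mathcal C]$, equipped with the ($\mathcal C$-enriched) Day convolution monoidal structure $$(F\mathbin{\overline\otimes} G)(m)=\int^{n,p\in\mathcal M}\mathcal M(m,n\oplus p)\cdot(Fn\times Gp),\qquad \text{unit } \mathcal M(-,e)\cdot 1,$$ where $S\cdot X=\coprod_{s\in S}X$ denotes the copower, and let $J:\mathcal C\to\overline{\mathcal M}$ be the functor $JX=\mathcal M(-,e)\cdot X$. Then strong $J$-relative monads on $\overline{\mathcal M}$ are in bijection with strong $\mathcal M$-graded monads on $\mathcal C$, where: * A *strong $J$-relative monad* $(T,\eta,(-)^*)$ on a monoidal category $(\mathcal D,\otimes,I)$ consists of objects $TX\in\mathcal D$, morphisms $\eta_X:JX\to TX$ and maps $(-)^*:\mathcal D(\Gamma\otimes JX,TY)\to\mathcal D(\Gamma\otimes TX,TY)$ natural in $\Gamma\in\mathcal D$, such that for $f:\Gamma\otimes JX\to TY$ and $g:\Delta\otimes JY\to TZ$: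 $(\eta_X\circ\lambda_{JX})^*=\lambda_{TX}$, $f^*\circ(\Gamma\otimes\eta_X)=f$, and $g^*\circ(\Delta\otimes f^*)\circ\alpha_{\Delta,\Gamma,TX}=(g^*\circ(\Delta\otimes f)\circ\alpha_{\Delta,\Gamma,JX})^*$. * A *strong $\mathcal M$-graded monad* on $\mathcal C$ consists of functors $T_{(-)}X:\mathcal M^{\mathrm{op}}\to\mathcal C$ for $X\in\mathcal C$, morphisms $\eta_X:X\to T_eX$ and maps $(-)^*_{m,n}:\mathcal C(\Gamma\times X,T_nY)\to\mathcal C(\Gamma\times T_mX,T_{m\oplus n}Y)$ natural in $\Gamma$ and $n$ and extranatural in $m$, such that for $f:\Gamma\times X\to T_mY$ and $g:\Gamma\times Y\to T_nZ$: $(\eta_X\circ\pi_X)^*_{m,e}=T_{\rho_m}X\circ\pi_{T_mX}$, $f^*_{e,m}\circ(\Gamma\times\eta_X)=T_{\lambda_m}Y\circ f$, and $g^*_{l\oplus m,n}\circ(\pi_\Gamma,f^*_{l,m})=T_{\alpha_{l,m,n}}Z\circ(g^*_{m,n}\circ(\pi_\Gamma,f))^*_{l,m\oplus n}$. Under the bijection,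 the functors agree, $(TX)(m)=T_mX$; the units correspond under the adjunction between $J$ and evaluation at $e$; and the extensions correspond as follows. For $h:F\mathbin{\overline\otimes}JX\to TY$ let $h_n:Fn\times X\to T_nY$ be its components under $(F\mathbin{\overline\otimes}JX)(n)\cong Fn\times X$. Then $(h_n)^*_{m,n}:Fn\times T_mX\to T_{m\oplus n}Y$ is the composite of the canonical map $Fn\times T_mX\to(F\mathbin{\overline\otimes}TX)(n\oplus m)$, the component of $h^*$ at $n\oplus m$, and the isomorphism $T_{n\oplus m}Y\cong T_{m\oplus n}Y$ given by the symmetry of $\mathcal M$. -/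

import Mathlib

open CategoryTheory MonoidalCategory CartesianMonoidalCategory Limits Opposite

universe w v u

namespace StrongMonads

/-- A strong `J`-relative monad on a monoidal category `D`, for a mapping of objects `J : A → D`,
in extension (Kleisli triple) form. -/
structure StrongRelativeMonad {A : Type*} {D : Type*} [Category D] [MonoidalCategory D]
    (J : A → D) where
  /-- the object `T a` -/
  obj : A → D
  /-- the unit `η_a : J a ⟶ T a` -/
  unit (a : A) : J a ⟶ obj a
  /-- the extension operator `(-)^*` -/
  ext {Γ : D} {a b : A} (f : Γ ⊗ J a ⟶ obj b) : Γ ⊗ obj a ⟶ obj b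
  /-- `(-)^*` is natural in the context `Γ` -/
  ext_natural {Γ Γ' : D} {a b : A} (h : Γ' ⟶ Γ) (f : Γ ⊗ J a ⟶ obj b) :
    ext (h ▷ J a ≫ f) = h ▷ obj a ≫ ext f
  ext_unit (a : A) : ext ((λ_ (J a)).hom ≫ unit a) = (λ_ (obj a)).hom
  unit_ext {Γ : D} {a b : A} (f : Γ ⊗ J a ⟶ obj b) : Γ ◁ unit a ≫ ext f = f
  ext_ext {Γ Δ : D} {a b c : A} (f : Γ ⊗ J a ⟶ obj b) (g : Δ ⊗ J b ⟶ obj c) :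
    (α_ Δ Γ (obj a)).hom ≫ Δ ◁ ext f ≫ ext g = ext ((α_ Δ Γ (J a)).hom ≫ Δ ◁ f ≫ ext g)

/-- A strong `M`-graded monad on a cartesian category `C` (with `⊗` the categorical product
of `C`), for a monoidal category `M` of grades. -/
structure StrongGradedMonad (M : Type*) [Category M] [MonoidalCategory M]
    (C : Type*) [Category C] [CartesianMonoidalCategory C] where
  /-- the functor `m ↦ T_m X` -/
  obj : C → Mᵒᵖ ⥤ C
  /-- the unit `η_X : X ⟶ T_e X` -/
  unit (X : C) : X ⟶ (obj X).obj (op (𝟙_ M))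
  /-- the extension operators `(-)^*_{m,n}` -/
  ext {Γ X Y : C} (m n : M) (f : Γ ⊗ X ⟶ (obj Y).obj (op n)) :
    Γ ⊗ (obj X).obj (op m) ⟶ (obj Y).obj (op (m ⊗ n))
  /-- naturality in the context `Γ` -/
  ext_natural_context {Γ Γ' X Y : C} (m n : M) (h : Γ' ⟶ Γ)
    (f : Γ ⊗ X ⟶ (obj Y).obj (op n)) :
    ext m n (h ▷ X ≫ f) = h ▷ (obj X).obj (op m) ≫ ext m n f
  /-- naturality in the grade `n` -/
  ext_natural_right {Γ X Y : C} (m : M) {n n' : M} (z : n' ⟶ n)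
    (f : Γ ⊗ X ⟶ (obj Y).obj (op n)) :
    ext m n' (f ≫ (obj Y).map z.op) = ext m n f ≫ (obj Y).map (m ◁ z).op
  /-- extranaturality in the grade `m` -/
  ext_extranatural_left {Γ X Y : C} {m m' : M} (n : M) (x : m' ⟶ m)
    (f : Γ ⊗ X ⟶ (obj Y).obj (op n)) :
    Γ ◁ (obj X).map x.op ≫ ext m' n f = ext m n f ≫ (obj Y).map (x ▷ n).op
  ext_unit (Γ X : C) (m : M) :
    ext m (𝟙_ M) (snd Γ X ≫ unit X) = snd Γ ((obj X).obj (op m)) ≫ (obj X).map (ρ_ m).hom.op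
  unit_ext {Γ X Y : C} (m : M) (f : Γ ⊗ X ⟶ (obj Y).obj (op m)) :
    Γ ◁ unit X ≫ ext (𝟙_ M) m f = f ≫ (obj Y).map (λ_ m).hom.op
  ext_ext {Γ X Y Z : C} (l m n : M) (f : Γ ⊗ X ⟶ (obj Y).obj (op m))
    (g : Γ ⊗ Y ⟶ (obj Z).obj (op n)) :
    lift (fst Γ ((obj X).obj (op l))) (ext l m f) ≫ ext (l ⊗ m) n g =
      ext l (m ⊗ n) (lift (fst Γ X) f ≫ ext m n g) ≫ (obj Z).map (α_ l m n).hom.op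

section Day

variable (M : Type w) [SmallCategory M] [MonoidalCategory M]
  (C : Type u) [Category.{v} C] [CartesianMonoidalCategory C]

/-! The following instances are the side conditions under which Mathlib equips
`DayFunctor Mᵒᵖ C`, i.e. functors `Mᵒᵖ ⥤ C`, with the Day convolution monoidal structure. -/

instance hasColimitsOfShape_unitCostructuredArrow [HasColimitsOfSize.{w, w} C] (d : Mᵒᵖ) :
    HasColimitsOfShape
      (CostructuredArrow (Functor.fromPUnit.{0} (𝟙_ Mᵒᵖ)) d) C :=
  hasColimitsOfShape_of_essentiallySmall.{w} _ C

instance preservesColimitsOfShape_tensorLeft [MonoidalClosed C] (X : C)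
    (K : Type*) [Category K] : PreservesColimitsOfShape K (tensorLeft X) :=
  (ihom.adjunction X).leftAdjoint_preservesColimits.preservesColimitsOfShape

instance preservesColimitsOfShape_tensorRight [MonoidalClosed C] (X : C)
    (K : Type*) [Category K] : PreservesColimitsOfShape K (tensorRight X) :=
  letI : BraidedCategory C := .ofCartesianMonoidalCategory
  preservesColimitsOfShape_of_natIso (BraidedCategory.tensorLeftIsoTensorRight X)

variable [MonoidalClosed C] [HasColimitsOfSize.{w, w} C]

/-- The root `J : C ⥤ [Mᵒᵖ, C]`, `J X = M(-, e) · X`, where `S · X = ∐_{s ∈ S} X` is the copower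
and `[Mᵒᵖ, C]` is regarded as the Day convolution monoidal category. -/
noncomputable def root : C ⥤ DayFunctor Mᵒᵖ C :=
  sigmaConst.{w} ⋙ (Functor.whiskeringLeft Mᵒᵖ (Type w) C).obj (yoneda.obj (𝟙_ M)) ⋙
    (DayFunctor.equiv Mᵒᵖ C).inverse

variable {M C}

/-- The unit `X ⟶ (J X)(e) = ∐_{M(e, e)} X` of the adjunction between `J` and evaluation at `e`:
the coprojection at the identity of `e`. -/
noncomputable def rootUnit (X : C) : X ⟶ ((root M C).obj X).functor.obj (op (𝟙_ M)) :=
  Sigma.ι (fun _ : (𝟙_ M ⟶ 𝟙_ M) => X) (𝟙 (𝟙_ M))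

/-- The component `F n × X ⟶ H n` at `n` corresponding to a morphism `h : F ⊗ J X ⟶ H` under the
canonical isomorphism `(F ⊗ J X) n ≅ F n × X`. -/
noncomputable def component {F H : DayFunctor Mᵒᵖ C} {X : C} (h : F ⊗ (root M C).obj X ⟶ H)
    (n : M) : F.functor.obj (op n) ⊗ X ⟶ H.functor.obj (op n) :=
  F.functor.obj (op n) ◁ rootUnit X ≫
    (DayFunctor.η F ((root M C).obj X)).app (op n, op (𝟙_ M)) ≫
    h.natTrans.app (op (n ⊗ 𝟙_ M)) ≫ H.functor.map (ρ_ n).inv.op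

/-- A strong relative monad `S` for the root `J` and a strong graded monad `G` correspond to each
other: they have the same underlying functors `Mᵒᵖ ⥤ C`; their units correspond under the
adjunction between `J` and evaluation at `e`; and, for each `h : F ⊗ J X ⟶ T Y` with components
`F n × X ⟶ T_n Y`, the graded extension of the component at `n` is the restriction of the relative
extension of `h` to `F n × T_m X`, followed by the symmetry on grades. -/
structure Corresponds [SymmetricCategory M]
    (S : StrongRelativeMonad (root M C).obj) (G : StrongGradedMonad M C) : Prop where
  obj_eq (X : C) : (S.obj X).functor = G.obj X
  unit_eq (X : C) :
    rootUnit X ≫ (S.unit X).natTrans.app (op (𝟙_ M)) ≫ (eqToHom (obj_eq X)).app (op (𝟙_ M)) =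
      G.unit X
  ext_eq (F : DayFunctor Mᵒᵖ C) (X Y : C) (h : F ⊗ (root M C).obj X ⟶ S.obj Y) (m n : M) :
    F.functor.obj (op n) ◁ (eqToHom (obj_eq X)).app (op m) ≫
        G.ext m n (component h n ≫ (eqToHom (obj_eq Y)).app (op n)) =
      (DayFunctor.η F (S.obj X)).app (op n, op m) ≫ (S.ext h).natTrans.app (op (n ⊗ m)) ≫
        (eqToHom (obj_eq Y)).app (op (n ⊗ m)) ≫ (G.obj Y).map (β_ m n).hom.op

end Day

end StrongMonads

namespace StrongMonads

/-! Both kinds of extension operator act on the same data. By the universal property of Day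
convolution, a map `F ⊗ G ⟶ H` is a natural family `F m × G n ⟶ H (m ⊗ n)`; since `J X` is a copower
of `X` on a representable and products preserve copowers, a map `F ⊗ J X ⟶ H` is a natural family `F
n × X ⟶ H n` (`component_injective`, `ofComponents`). A graded extension thus acts on components,
its (extra)naturality being what makes the results assemble into a map `F ⊗ T X ⟶ T Y`.

Conversely, a single map `f : Γ × X ⟶ T_n Y` has no presheaf in its context. The pointwise
exponential `(T Y)^X` supplies one: `f` is the component at `n` of evaluation, precomposed with the
transpose of `f` (`exists_component`). Extending the evaluation defines the graded extension, and
naturality in the context gives the same value for every other presentation of `f`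
(`gradedExt_whiskerRight_component`). Each law then transfers by choosing suitable presentations.
Day convolution puts the grade of the context first and the graded monad puts it last, so braidings
intervene throughout. -/

lemma braiding_tensor_left_whiskerLeft {M : Type*} [Category M] [MonoidalCategory M]
    [BraidedCategory M] (l m n : M) :
    (β_ (l ⊗ m) n).hom ≫ n ◁ (β_ l m).hom =
      (α_ l m n).hom ≫ (β_ l (m ⊗ n)).hom ≫ (β_ m n).hom ▷ l ≫ (α_ n m l).hom := by
  rw [← BraidedCategory.braiding_naturality_right_assoc,
    BraidedCategory.braiding_tensor_left_hom, BraidedCategory.braiding_tensor_right_hom]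
  simp

lemma lift_fst_whiskerRight {C : Type*} [Category C] [CartesianMonoidalCategory C]
    {Γ A B B' D : C} (c : Γ ⟶ A) (d : Γ ⟶ B) (x : A ⊗ D ⟶ B') :
    lift (fst Γ D) (c ▷ D ≫ x) ≫ d ▷ B' = lift d c ▷ D ≫ (α_ B A D).hom ≫ B ◁ x := by
  apply CartesianMonoidalCategory.hom_ext
  · simp
  · simp only [Category.assoc, whiskerLeft_snd, whiskerRight_snd, lift_snd]
    rw [← Category.assoc, ← Category.assoc]
    congr 1
    apply CartesianMonoidalCategory.hom_ext <;> simp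

lemma lift_fst_snd_whiskerRight {C : Type*} [Category C] [CartesianMonoidalCategory C]
    {Γ Δ X Y Z : C} (f : Γ ⊗ X ⟶ Y) (g : Δ ⊗ Y ⟶ Z) :
    lift (fst (Δ ⊗ Γ) X) (snd Δ Γ ▷ X ≫ f) ≫ fst Δ Γ ▷ Y ≫ g = (α_ Δ Γ X).hom ≫ Δ ◁ f ≫ g := by
  have h := lift_fst_whiskerRight (snd Δ Γ) (fst Δ Γ) f
  rw [lift_fst_snd, id_whiskerRight, Category.id_comp] at h
  rw [reassoc_of% h]

lemma StrongRelativeMonad.eq_of_heq {A : Type*} {D : Type*} [Category D] [MonoidalCategory D]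
    {J : A → D} {S S' : StrongRelativeMonad J} (hobj : S.obj = S'.obj) (hunit : S.unit ≍ S'.unit)
    (hext : @S.ext ≍ @S'.ext) : S = S' := by
  cases S
  cases S'
  cases hobj
  cases hunit
  cases hext
  rfl

lemma StrongGradedMonad.eq_of_heq {M : Type*} [Category M] [MonoidalCategory M]
    {C : Type*} [Category C] [CartesianMonoidalCategory C] {G G' : StrongGradedMonad M C}
    (hobj : G.obj = G'.obj) (hunit : G.unit ≍ G'.unit) (hext : @G.ext ≍ @G'.ext) : G = G' := by
  cases G
  cases G'
  cases hobj
  cases hunit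
  cases hext
  rfl

/-- The associativity law with separate contexts, as relative monads require: apply `ext_ext` in the
context `Δ ⊗ Γ` to the pullbacks along the projections, which naturality in the context then moves
outside. -/
lemma StrongGradedMonad.ext_ext_tensor {M : Type*} [Category M] [MonoidalCategory M]
    {C : Type*} [Category C] [CartesianMonoidalCategory C] (G : StrongGradedMonad M C)
    {Γ Δ X Y Z : C} (l m n : M) (f : Γ ⊗ X ⟶ (G.obj Y).obj (op m))
    (g : Δ ⊗ Y ⟶ (G.obj Z).obj (op n)) :
    (α_ Δ Γ _).hom ≫ Δ ◁ G.ext l m f ≫ G.ext (l ⊗ m) n g =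
      G.ext l (m ⊗ n) ((α_ Δ Γ X).hom ≫ Δ ◁ f ≫ G.ext m n g) ≫ (G.obj Z).map (α_ l m n).hom.op := by
  have h := G.ext_ext l m n (snd Δ Γ ▷ X ≫ f) (fst Δ Γ ▷ Y ≫ g)
  rwa [G.ext_natural_context, G.ext_natural_context, G.ext_natural_context,
    lift_fst_snd_whiskerRight, lift_fst_snd_whiskerRight] at h

/-- Obtained by inverting `braiding_tensor_left_whiskerLeft`; it reconciles the orders of three
grades in the associativity law for `toRelative`. -/
lemma braiding_inv_tensor_left_associator {M : Type*} [Category M] [MonoidalCategory M]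
    [BraidedCategory M] (m n p : M) :
    (α_ p n m).hom ≫ p ◁ (β_ m n).inv ≫ (β_ (m ⊗ n) p).inv ≫ (α_ m n p).hom =
      (β_ m (p ⊗ n)).inv ≫ m ◁ (β_ n p).inv := by
  have h := IsIso.inv_eq_inv.mpr (braiding_tensor_left_whiskerLeft m n p)
  simp only [IsIso.inv_comp, inv_whiskerLeft, inv_whiskerRight, IsIso.Iso.inv_hom,
    Category.assoc] at h
  rw [reassoc_of% h, Iso.hom_inv_id_assoc, ← BraidedCategory.braiding_inv_naturality_left]
  simp only [Iso.inv_hom_id, Category.comp_id]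

section Day

variable {M : Type w} [SmallCategory M] [MonoidalCategory M]
  {C : Type u} [Category.{v} C] [CartesianMonoidalCategory C]
  [MonoidalClosed C] [HasColimitsOfSize.{w, w} C]

/-! ### Day convolution through its universal maps -/

open scoped ExternalProduct in
local instance hasPointwiseLeftKanExtension_tensor (F G : Mᵒᵖ ⥤ C) :
    (tensor Mᵒᵖ).HasPointwiseLeftKanExtension (F ⊠ G) := inferInstance

local instance hasPointwiseLeftKanExtension_unit :
    (Functor.fromPUnit.{0} (𝟙_ Mᵒᵖ)).HasPointwiseLeftKanExtension
      (Functor.fromPUnit.{0} (𝟙_ C)) := inferInstance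

/-- The canonical map `F m × G n ⟶ (F ⊗ G)(m ⊗ n)` into the Day convolution. -/
noncomputable def pair (F G : DayFunctor Mᵒᵖ C) (m n : M) :
    F.functor.obj (op m) ⊗ G.functor.obj (op n) ⟶ (F ⊗ G).functor.obj (op (m ⊗ n)) :=
  (DayFunctor.η F G).app (op m, op n)

lemma pair_naturality_left (F G : DayFunctor Mᵒᵖ C) {m m' : M} (x : m' ⟶ m) (n : M) :
    F.functor.map x.op ▷ G.functor.obj (op n) ≫ pair F G m' n =
      pair F G m n ≫ (F ⊗ G).functor.map (x ▷ n).op := by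
  have h := (DayFunctor.η F G).naturality (X := (op m, op n)) (Y := (op m', op n)) (x.op, 𝟙 _)
  simpa [pair] using h

lemma pair_naturality_right (F G : DayFunctor Mᵒᵖ C) (m : M) {n n' : M} (z : n' ⟶ n) :
    F.functor.obj (op m) ◁ G.functor.map z.op ≫ pair F G m n' =
      pair F G m n ≫ (F ⊗ G).functor.map (m ◁ z).op := by
  have h := (DayFunctor.η F G).naturality (X := (op m, op n)) (Y := (op m, op n')) (𝟙 _, z.op)
  simpa [pair] using h

lemma pair_whiskerLeft (F : DayFunctor Mᵒᵖ C) {G G' : DayFunctor Mᵒᵖ C} (g : G ⟶ G') (m n : M) :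
    pair F G m n ≫ (F ◁ g).natTrans.app (op (m ⊗ n)) =
      F.functor.obj (op m) ◁ g.natTrans.app (op n) ≫ pair F G' m n :=
  LawfulDayConvolutionMonoidalCategoryStruct.convolutionExtensionUnit_comp_ι_map_whiskerLeft_app
    C F g (op m) (op n)

lemma pair_whiskerRight {F F' : DayFunctor Mᵒᵖ C} (f : F ⟶ F') (G : DayFunctor Mᵒᵖ C) (m n : M) :
    pair F G m n ≫ (f ▷ G).natTrans.app (op (m ⊗ n)) =
      f.natTrans.app (op m) ▷ G.functor.obj (op n) ≫ pair F' G m n :=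
  LawfulDayConvolutionMonoidalCategoryStruct.convolutionExtensionUnit_comp_ι_map_whiskerRight_app
    Mᵒᵖ C f G (op m) (op n)

lemma pair_associator (F G H : DayFunctor Mᵒᵖ C) (l m n : M) :
    pair F G l m ▷ H.functor.obj (op n) ≫ pair (F ⊗ G) H (l ⊗ m) n ≫
        (α_ F G H).hom.natTrans.app (op ((l ⊗ m) ⊗ n)) =
      (α_ _ _ _).hom ≫ F.functor.obj (op l) ◁ pair G H m n ≫ pair F (G ⊗ H) l (m ⊗ n) ≫
        (F ⊗ G ⊗ H).functor.map (α_ l m n).hom.op :=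
  LawfulDayConvolutionMonoidalCategoryStruct.associator_hom_unit_unit
    C F G H (op l) (op m) (op n)

variable (M C) in
/-- The canonical map `1 ⟶ I e` into the unit `I` of Day convolution. -/
noncomputable def dayUnit : 𝟙_ C ⟶ (𝟙_ (DayFunctor Mᵒᵖ C)).functor.obj (op (𝟙_ M)) :=
  DayFunctor.ν Mᵒᵖ C

lemma pair_leftUnitor (F : DayFunctor Mᵒᵖ C) (n : M) :
    dayUnit M C ▷ F.functor.obj (op n) ≫ pair (𝟙_ (DayFunctor Mᵒᵖ C)) F (𝟙_ M) n ≫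
        (λ_ F).hom.natTrans.app (op (𝟙_ M ⊗ n)) =
      (λ_ _).hom ≫ F.functor.map (λ_ n).hom.op :=
  LawfulDayConvolutionMonoidalCategoryStruct.leftUnitor_hom_unit_app C F (op n)

lemma pair_hom_ext {F G H : DayFunctor Mᵒᵖ C} {f g : F ⊗ G ⟶ H}
    (h : ∀ m n : M, pair F G m n ≫ f.natTrans.app (op (m ⊗ n)) =
      pair F G m n ≫ g.natTrans.app (op (m ⊗ n))) : f = g :=
  DayFunctor.tensor_hom_ext fun x y => h x.unop y.unop

open DayConvolution LawfulDayConvolutionMonoidalCategoryStruct ExternalProduct in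
/-- Morphisms out of a threefold Day convolution are determined by their restrictions to
`F l × G m × H n`. -/
lemma pair_pair_hom_ext {F G H K : DayFunctor Mᵒᵖ C} {f g : (F ⊗ G) ⊗ H ⟶ K}
    (h : ∀ l m n : M,
      pair F G l m ▷ H.functor.obj (op n) ≫ pair (F ⊗ G) H (l ⊗ m) n ≫
          f.natTrans.app (op ((l ⊗ m) ⊗ n)) =
        pair F G l m ▷ H.functor.obj (op n) ≫ pair (F ⊗ G) H (l ⊗ m) n ≫
          g.natTrans.app (op ((l ⊗ m) ⊗ n))) : f = g := by
  let := convolution Mᵒᵖ C (DayFunctor Mᵒᵖ C) F G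
  let := convolution₂' Mᵒᵖ C (DayFunctor Mᵒᵖ C) F G H
  let ι := LawfulDayConvolutionMonoidalCategoryStruct.ι Mᵒᵖ C (DayFunctor Mᵒᵖ C)
  apply DayFunctor.hom_ext
  apply Functor.hom_ext_of_isLeftKanExtension _ (unit (ι.obj F ⊛ ι.obj G) (ι.obj H)) _
  -- Products preserve colimits in each variable, so the universal map for `F` and `G` remains a
  -- left Kan extension after pairing with `H`.
  apply Functor.hom_ext_of_isLeftKanExtension _
    (extensionUnitLeft (ι.obj F ⊛ ι.obj G) (unit (ι.obj F) (ι.obj G)) (ι.obj H)) _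
  apply NatTrans.ext
  funext ⟨⟨l, m⟩, n⟩
  simpa using! h l.unop m.unop n.unop

/-- A natural family of maps `F m × G n ⟶ H (m ⊗ n)` induces a map `F ⊗ G ⟶ H`. -/
noncomputable def pairDesc {F G H : DayFunctor Mᵒᵖ C}
    (a : ∀ m n : M, F.functor.obj (op m) ⊗ G.functor.obj (op n) ⟶ H.functor.obj (op (m ⊗ n)))
    (hl : ∀ (m m' : M) (x : m' ⟶ m) (n : M), F.functor.map x.op ▷ G.functor.obj (op n) ≫ a m' n =
      a m n ≫ H.functor.map (x ▷ n).op)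
    (hr : ∀ (m n n' : M) (z : n' ⟶ n), F.functor.obj (op m) ◁ G.functor.map z.op ≫ a m n' =
      a m n ≫ H.functor.map (m ◁ z).op) : F ⊗ G ⟶ H :=
  DayFunctor.tensorDesc
    { app := fun p => a p.1.unop p.2.unop
      naturality := by
        rintro ⟨m, n⟩ ⟨m', n'⟩ ⟨x, z⟩
        have h₁ := hl _ _ x.unop n.unop
        have h₂ := hr m'.unop _ _ z.unop
        simp only [Quiver.Hom.op_unop] at h₁ h₂
        have hxz : H.functor.map (x ⊗ₘ z) = H.functor.map (x.unop ▷ n.unop).op ≫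
            H.functor.map (m'.unop ◁ z.unop).op := by
          rw [← Functor.map_comp, MonoidalCategory.tensorHom_def]
          rfl
        simp only [externalProductBifunctor_obj_map, Functor.comp_map, tensor_map, Category.assoc]
        rw [hxz]
        dsimp at h₁ h₂ ⊢
        rw [h₂, reassoc_of% h₁] }

@[simp]
lemma pair_pairDesc {F G H : DayFunctor Mᵒᵖ C}
    (a : ∀ m n : M, F.functor.obj (op m) ⊗ G.functor.obj (op n) ⟶ H.functor.obj (op (m ⊗ n)))
    (hl : ∀ (m m' : M) (x : m' ⟶ m) (n : M), F.functor.map x.op ▷ G.functor.obj (op n) ≫ a m' n =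
      a m n ≫ H.functor.map (x ▷ n).op)
    (hr : ∀ (m n n' : M) (z : n' ⟶ n), F.functor.obj (op m) ◁ G.functor.map z.op ≫ a m n' =
      a m n ≫ H.functor.map (m ◁ z).op) (m n : M) :
    pair F G m n ≫ (pairDesc a hl hr).natTrans.app (op (m ⊗ n)) = a m n :=
  DayFunctor.η_comp_tensorDesc_app _ (op m) (op n)

/-! ### Maps out of `J X` and `F ⊗ J X` -/

omit [MonoidalClosed C] in
lemma rootUnit_map (X : C) {n : M} (u : n ⟶ 𝟙_ M) :
    rootUnit X ≫ ((root M C).obj X).functor.map u.op =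
      Sigma.ι (fun _ : (n ⟶ 𝟙_ M) => X) u := by
  change Sigma.ι (fun _ : (𝟙_ M ⟶ 𝟙_ M) => X) (𝟙 (𝟙_ M)) ≫
    Sigma.map' (g := fun _ : (n ⟶ 𝟙_ M) => X) (fun v => u ≫ v) (fun _ => 𝟙 X) = _
  simp

/-- A family of maps `X ⟶ Z` indexed by `M(n, e)` induces a map `(J X) n ⟶ Z`. -/
noncomputable def rootDesc {X Z : C} {n : M} (f : (n ⟶ 𝟙_ M) → (X ⟶ Z)) :
    ((root M C).obj X).functor.obj (op n) ⟶ Z :=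
  Sigma.desc f

omit [MonoidalClosed C] in
@[simp]
lemma rootUnit_map_rootDesc {X Z : C} {n : M} (f : (n ⟶ 𝟙_ M) → (X ⟶ Z)) (u : n ⟶ 𝟙_ M) :
    rootUnit X ≫ ((root M C).obj X).functor.map u.op ≫ rootDesc f = f u := by
  rw [reassoc_of% rootUnit_map]
  exact Sigma.ι_desc f u

omit [MonoidalClosed C] in
@[simp]
lemma rootUnit_rootDesc {X Z : C} (f : (𝟙_ M ⟶ 𝟙_ M) → (X ⟶ Z)) :
    rootUnit X ≫ rootDesc f = f (𝟙 _) := by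
  simpa using rootUnit_map_rootDesc f (𝟙 _)

omit [MonoidalClosed C] in
lemma root_hom_ext {X Z : C} {n : M} {f g : ((root M C).obj X).functor.obj (op n) ⟶ Z}
    (h : ∀ u : n ⟶ 𝟙_ M, rootUnit X ≫ ((root M C).obj X).functor.map u.op ≫ f =
      rootUnit X ≫ ((root M C).obj X).functor.map u.op ≫ g) : f = g := by
  refine Sigma.hom_ext (f := fun _ : (n ⟶ 𝟙_ M) => X) _ _ fun u => ?_
  have hu := h u
  rw [reassoc_of% rootUnit_map, reassoc_of% rootUnit_map] at hu
  exact hu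

/-- Currying moves `A` to the codomain, leaving a map out of a coproduct. -/
lemma whiskerLeft_root_hom_ext {A X Z : C} {n : M}
    {f g : A ⊗ ((root M C).obj X).functor.obj (op n) ⟶ Z}
    (h : ∀ u : n ⟶ 𝟙_ M, A ◁ rootUnit X ≫ A ◁ ((root M C).obj X).functor.map u.op ≫ f =
      A ◁ rootUnit X ≫ A ◁ ((root M C).obj X).functor.map u.op ≫ g) : f = g := by
  apply MonoidalClosed.curry_injective
  refine root_hom_ext fun u => ?_
  simpa only [MonoidalClosed.curry_natural_left] using congrArg MonoidalClosed.curry (h u)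

lemma component_eq {F H : DayFunctor Mᵒᵖ C} {X : C} (h : F ⊗ (root M C).obj X ⟶ H) (n : M) :
    component h n = F.functor.obj (op n) ◁ rootUnit X ≫ pair F ((root M C).obj X) n (𝟙_ M) ≫
      h.natTrans.app (op (n ⊗ 𝟙_ M)) ≫ H.functor.map (ρ_ n).inv.op :=
  rfl

lemma component_naturality {F H : DayFunctor Mᵒᵖ C} {X : C} (h : F ⊗ (root M C).obj X ⟶ H)
    {n n' : M} (z : n' ⟶ n) :
    F.functor.map z.op ▷ X ≫ component h n' = component h n ≫ H.functor.map z.op := by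
  have hz : h.natTrans.app (op (n ⊗ 𝟙_ M)) ≫ H.functor.map (ρ_ n).inv.op ≫ H.functor.map z.op =
      (F ⊗ (root M C).obj X).functor.map (z ▷ 𝟙_ M).op ≫ h.natTrans.app (op (n' ⊗ 𝟙_ M)) ≫
        H.functor.map (ρ_ n').inv.op := by
    rw [← Functor.map_comp, ← op_comp, rightUnitor_inv_naturality, op_comp, Functor.map_comp,
      NatTrans.naturality_assoc]
  rw [component_eq, component_eq, ← whisker_exchange_assoc, reassoc_of% pair_naturality_left]
  simp only [Category.assoc, hz]

lemma whiskerRight_component {F F' H : DayFunctor Mᵒᵖ C} {X : C} (k : F ⟶ F')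
    (h : F' ⊗ (root M C).obj X ⟶ H) (n : M) :
    component (k ▷ (root M C).obj X ≫ h) n = k.natTrans.app (op n) ▷ X ≫ component h n := by
  simp only [component_eq, DayFunctor.comp_natTrans, NatTrans.comp_app, Category.assoc,
    reassoc_of% pair_whiskerRight, whisker_exchange_assoc]

/-- The restriction of `h` to every summand `u` is forced by its components; this formula yields
injectivity and dictates the definition of `ofComponents`. -/
lemma whiskerLeft_rootUnit_map_pair {F H : DayFunctor Mᵒᵖ C} {X : C}
    (h : F ⊗ (root M C).obj X ⟶ H) (m : M) {n : M} (u : n ⟶ 𝟙_ M) :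
    F.functor.obj (op m) ◁ rootUnit X ≫
        F.functor.obj (op m) ◁ ((root M C).obj X).functor.map u.op ≫
          pair F ((root M C).obj X) m n ≫ h.natTrans.app (op (m ⊗ n)) =
      component h m ≫ H.functor.map (m ◁ u ≫ (ρ_ m).hom).op := by
  rw [reassoc_of% pair_naturality_right, NatTrans.naturality, component_eq]
  simp only [Category.assoc, ← Functor.map_comp, ← op_comp, Iso.hom_inv_id, Category.comp_id]

lemma component_injective {F H : DayFunctor Mᵒᵖ C} {X : C} {f g : F ⊗ (root M C).obj X ⟶ H}
    (h : ∀ n, component f n = component g n) : f = g := by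
  refine pair_hom_ext fun m n => whiskerLeft_root_hom_ext fun u => ?_
  rw [whiskerLeft_rootUnit_map_pair, whiskerLeft_rootUnit_map_pair, h]

lemma whiskerLeft_uncurry_rootDesc {A X Z : C} {n : M} (f : (n ⟶ 𝟙_ M) → (A ⊗ X ⟶ Z))
    (u : n ⟶ 𝟙_ M) :
    A ◁ rootUnit X ≫ A ◁ ((root M C).obj X).functor.map u.op ≫
      MonoidalClosed.uncurry (rootDesc fun u => MonoidalClosed.curry (f u)) = f u := by
  rw [← MonoidalClosed.uncurry_natural_left, ← MonoidalClosed.uncurry_natural_left,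
    rootUnit_map_rootDesc, MonoidalClosed.uncurry_curry]

/-- The morphism `F ⊗ J X ⟶ H` with given components. -/
noncomputable def ofComponents {F H : DayFunctor Mᵒᵖ C} {X : C}
    (a : ∀ n : M, F.functor.obj (op n) ⊗ X ⟶ H.functor.obj (op n))
    (ha : ∀ (n n' : M) (z : n' ⟶ n),
      F.functor.map z.op ▷ X ≫ a n' = a n ≫ H.functor.map z.op) :
    F ⊗ (root M C).obj X ⟶ H :=
  pairDesc (fun m n => MonoidalClosed.uncurry (rootDesc fun u =>
      MonoidalClosed.curry (a m ≫ H.functor.map (m ◁ u ≫ (ρ_ m).hom).op)))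
    (by
      intro m m' x n
      refine whiskerLeft_root_hom_ext fun u => ?_
      rw [reassoc_of% whiskerLeft_uncurry_rootDesc, whisker_exchange_assoc, whisker_exchange_assoc,
        whiskerLeft_uncurry_rootDesc, reassoc_of% ha]
      simp only [Category.assoc, ← Functor.map_comp, ← op_comp, ← rightUnitor_naturality,
        whisker_exchange_assoc])
    (by
      intro m n n' z
      refine whiskerLeft_root_hom_ext fun u => ?_
      rw [reassoc_of% whiskerLeft_uncurry_rootDesc, ← whiskerLeft_comp_assoc (X := _) (f := _)
        (g := ((root M C).obj X).functor.map z.op), ← Functor.map_comp, ← op_comp,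
        whiskerLeft_uncurry_rootDesc]
      simp only [Category.assoc, ← Functor.map_comp, ← op_comp,
        MonoidalCategory.whiskerLeft_comp])

@[simp]
lemma component_ofComponents {F H : DayFunctor Mᵒᵖ C} {X : C}
    (a : ∀ n : M, F.functor.obj (op n) ⊗ X ⟶ H.functor.obj (op n))
    (ha : ∀ (n n' : M) (z : n' ⟶ n),
      F.functor.map z.op ▷ X ≫ a n' = a n ≫ H.functor.map z.op) (n : M) :
    component (ofComponents a ha) n = a n := by
  have h := whiskerLeft_uncurry_rootDesc
    (fun u => a n ≫ H.functor.map (n ◁ u ≫ (ρ_ n).hom).op) (𝟙 (𝟙_ M))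
  rw [op_id, CategoryTheory.Functor.map_id, MonoidalCategory.whiskerLeft_id, Category.id_comp] at h
  rw [component_eq, ofComponents, reassoc_of% pair_pairDesc, reassoc_of% h]
  simp [← Functor.map_comp]

/-! ### Pointwise exponentials and presentations of maps `Γ × X ⟶ H n` -/

/-- Evaluation `Z ^ X × X ⟶ Z`. -/
noncomputable def evalRight (X Z : C) : (ihom X).obj Z ⊗ X ⟶ Z :=
  lift (snd _ _) (fst _ _) ≫ (ihom.ev X).app Z

/-- The transpose `Γ ⟶ Z ^ X` of a map `Γ × X ⟶ Z`. -/
noncomputable def curryRight {Γ X Z : C} (f : Γ ⊗ X ⟶ Z) : Γ ⟶ (ihom X).obj Z :=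
  MonoidalClosed.curry (lift (snd _ _) (fst _ _) ≫ f)

omit [HasColimitsOfSize.{w, w} C] in
@[simp]
lemma curryRight_evalRight {Γ X Z : C} (f : Γ ⊗ X ⟶ Z) :
    curryRight f ▷ X ≫ evalRight X Z = f := by
  have h : curryRight f ▷ X ≫ lift (snd _ _) (fst _ _) =
      lift (snd Γ X) (fst Γ X) ≫ X ◁ curryRight f := by
    ext <;> simp
  rw [evalRight, reassoc_of% h, curryRight, ← MonoidalClosed.uncurry_eq,
    MonoidalClosed.uncurry_curry, ← Category.assoc]
  have : lift (snd Γ X) (fst Γ X) ≫ lift (snd X Γ) (fst X Γ) = 𝟙 _ := by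
    ext <;> simp
  rw [this, Category.id_comp]

omit [HasColimitsOfSize.{w, w} C] in
lemma evalRight_hom_ext {Γ X Z : C} {f g : Γ ⟶ (ihom X).obj Z}
    (h : f ▷ X ≫ evalRight X Z = g ▷ X ≫ evalRight X Z) : f = g := by
  apply MonoidalClosed.uncurry_injective
  rw [MonoidalClosed.uncurry_eq, MonoidalClosed.uncurry_eq]
  have key (f : Γ ⟶ (ihom X).obj Z) : X ◁ f ≫ (ihom.ev X).app Z =
      lift (snd X Γ) (fst X Γ) ≫ f ▷ X ≫ evalRight X Z := by
    rw [evalRight, ← Category.assoc, ← Category.assoc]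
    congr 1
    ext <;> simp
  rw [key, key, h]

omit [HasColimitsOfSize.{w, w} C] in
lemma evalRight_naturality {X Z Z' : C} (g : Z ⟶ Z') :
    (ihom X).map g ▷ X ≫ evalRight X Z' = evalRight X Z ≫ g := by
  have h : (ihom X).map g ▷ X ≫ lift (snd _ _) (fst _ _) =
      lift (snd _ _) (fst _ _) ≫ X ◁ (ihom X).map g := by
    ext <;> simp
  rw [evalRight, reassoc_of% h, evalRight, Category.assoc, ihom.ev_naturality]

/-- The right adjoint of `- ⊗ J X`: pointwise exponentiation by `X`. -/
noncomputable def homRoot (X : C) (H : DayFunctor Mᵒᵖ C) : DayFunctor Mᵒᵖ C :=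
  ⟨H.functor ⋙ ihom X⟩

/-- The counit of the adjunction between `- ⊗ J X` and pointwise exponentiation by `X`. -/
noncomputable def evalRoot (X : C) (H : DayFunctor Mᵒᵖ C) :
    homRoot X H ⊗ (root M C).obj X ⟶ H :=
  ofComponents (fun n => evalRight X (H.functor.obj (op n)))
    (fun _ _ z => evalRight_naturality (H.functor.map z.op))

/-- The transpose `Γ ⟶ (H ^ X) n` of a map `Γ × X ⟶ H n`. -/
noncomputable def curryRootApp {Γ X : C} {H : DayFunctor Mᵒᵖ C} {n : M}
    (f : Γ ⊗ X ⟶ H.functor.obj (op n)) : Γ ⟶ (homRoot X H).functor.obj (op n) :=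
  curryRight f

@[simp]
lemma curryRootApp_component_evalRoot {Γ X : C} {H : DayFunctor Mᵒᵖ C} {n : M}
    (f : Γ ⊗ X ⟶ H.functor.obj (op n)) :
    curryRootApp f ▷ X ≫ component (evalRoot X H) n = f :=
  (congrArg _ (component_ofComponents _ _ n)).trans (curryRight_evalRight f)

lemma homRoot_hom_ext {Γ X : C} {H : DayFunctor Mᵒᵖ C} {n : M}
    {f g : Γ ⟶ (homRoot X H).functor.obj (op n)}
    (h : f ▷ X ≫ component (evalRoot X H) n = g ▷ X ≫ component (evalRoot X H) n) : f = g := by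
  have key (f : Γ ⟶ (homRoot X H).functor.obj (op n)) : f ▷ X ≫ component (evalRoot X H) n =
      f ▷ X ≫ evalRight X (H.functor.obj (op n)) :=
    congrArg _ (component_ofComponents _ _ n)
  exact evalRight_hom_ext ((key f).symm.trans (h.trans (key g)))

/-- The transpose of a morphism `F ⊗ J X ⟶ H`. -/
noncomputable def curryRoot {F H : DayFunctor Mᵒᵖ C} {X : C} (h : F ⊗ (root M C).obj X ⟶ H) :
    F ⟶ homRoot X H :=
  ⟨{ app := fun n => curryRootApp (component h n.unop)
     naturality := fun n n' z => homRoot_hom_ext (by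
      have hz := component_naturality h z.unop
      have hz' := component_naturality (evalRoot X H) z.unop
      simp only [Quiver.Hom.op_unop, op_unop] at hz hz'
      rw [comp_whiskerRight_assoc, comp_whiskerRight_assoc, curryRootApp_component_evalRoot]
      erw [hz', hz]
      rw [← Category.assoc, curryRootApp_component_evalRoot]) }⟩

lemma curryRoot_app {F H : DayFunctor Mᵒᵖ C} {X : C} (h : F ⊗ (root M C).obj X ⟶ H) (n : M) :
    (curryRoot h).natTrans.app (op n) = curryRootApp (component h n) :=
  rfl

lemma curryRoot_evalRoot {F H : DayFunctor Mᵒᵖ C} {X : C} (h : F ⊗ (root M C).obj X ⟶ H) :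
    curryRoot h ▷ (root M C).obj X ≫ evalRoot X H = h :=
  component_injective fun n => by
    rw [whiskerRight_component, curryRoot_app, curryRootApp_component_evalRoot]

lemma exists_component {Γ X : C} {H : DayFunctor Mᵒᵖ C} {n : M}
    (f : Γ ⊗ X ⟶ H.functor.obj (op n)) :
    ∃ (F : DayFunctor Mᵒᵖ C) (h : F ⊗ (root M C).obj X ⟶ H) (c : Γ ⟶ F.functor.obj (op n)),
      f = c ▷ X ≫ component h n :=
  ⟨homRoot X H, evalRoot X H, curryRootApp f, (curryRootApp_component_evalRoot f).symm⟩

/-! ### From relative monads to graded monads -/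

namespace StrongRelativeMonad

variable [SymmetricCategory M] (S : StrongRelativeMonad (root M C).obj)

/-- The extension operators of the graded monad induced by a strong relative monad. -/
noncomputable def gradedExt {Γ X Y : C} (m n : M) (f : Γ ⊗ X ⟶ (S.obj Y).functor.obj (op n)) :
    Γ ⊗ (S.obj X).functor.obj (op m) ⟶ (S.obj Y).functor.obj (op (m ⊗ n)) :=
  curryRootApp f ▷ (S.obj X).functor.obj (op m) ≫ pair (homRoot X (S.obj Y)) (S.obj X) n m ≫
    (S.ext (evalRoot X (S.obj Y))).natTrans.app (op (n ⊗ m)) ≫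
      (S.obj Y).functor.map (β_ m n).hom.op

lemma gradedExt_whiskerRight_component {Γ X Y : C} (m n : M) {F : DayFunctor Mᵒᵖ C}
    (h : F ⊗ (root M C).obj X ⟶ S.obj Y) (c : Γ ⟶ F.functor.obj (op n)) :
    S.gradedExt m n (c ▷ X ≫ component h n) =
      c ▷ (S.obj X).functor.obj (op m) ≫ pair F (S.obj X) n m ≫
        (S.ext h).natTrans.app (op (n ⊗ m)) ≫ (S.obj Y).functor.map (β_ m n).hom.op := by
  have hc : curryRootApp (c ▷ X ≫ component h n) = c ≫ (curryRoot h).natTrans.app (op n) :=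
    homRoot_hom_ext (by
      rw [curryRootApp_component_evalRoot, comp_whiskerRight_assoc, curryRoot_app,
        curryRootApp_component_evalRoot])
  -- Every `h` factors through the evaluation, so naturality in the context determines its
  -- extension.
  have hh : S.ext h = curryRoot h ▷ S.obj X ≫ S.ext (evalRoot X (S.obj Y)) := by
    rw [← S.ext_natural, curryRoot_evalRoot]
  rw [gradedExt, hc, hh, comp_whiskerRight_assoc, ← reassoc_of% pair_whiskerRight]
  simp only [DayFunctor.comp_natTrans, NatTrans.comp_app, Category.assoc]

lemma gradedExt_component {X Y : C} (m n : M) {F : DayFunctor Mᵒᵖ C}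
    (h : F ⊗ (root M C).obj X ⟶ S.obj Y) :
    S.gradedExt m n (component h n) = pair F (S.obj X) n m ≫
      (S.ext h).natTrans.app (op (n ⊗ m)) ≫ (S.obj Y).functor.map (β_ m n).hom.op := by
  simpa only [id_whiskerRight, Category.id_comp] using
    S.gradedExt_whiskerRight_component m n h (𝟙 _)

lemma gradedExt_component_braiding_inv {X Y : C} (m n : M) {F : DayFunctor Mᵒᵖ C}
    (h : F ⊗ (root M C).obj X ⟶ S.obj Y) :
    S.gradedExt m n (component h n) ≫ (S.obj Y).functor.map (β_ m n).inv.op =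
      pair F (S.obj X) n m ≫ (S.ext h).natTrans.app (op (n ⊗ m)) := by
  rw [gradedExt_component]
  simp only [Category.assoc, ← Functor.map_comp, ← op_comp, Iso.inv_hom_id, op_id,
    CategoryTheory.Functor.map_id, Category.comp_id]

end StrongRelativeMonad

/-- Identifies Kleisli composition over Day convolution with composition of components; both
associativity laws rest on it. -/
lemma pair_component_associator {F G H K : DayFunctor Mᵒᵖ C} {X : C}
    (h : F ⊗ (root M C).obj X ⟶ H) (k : G ⊗ H ⟶ K) (p n : M) :
    pair G F p n ▷ X ≫ component ((α_ G F _).hom ≫ G ◁ h ≫ k) (p ⊗ n) =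
      (α_ _ _ _).hom ≫ G.functor.obj (op p) ◁ component h n ≫ pair G H p n ≫
        k.natTrans.app (op (p ⊗ n)) := by
  have hk : K.functor.map (α_ p n (𝟙_ M)).hom.op ≫ K.functor.map (ρ_ (p ⊗ n)).inv.op =
      K.functor.map (p ◁ (ρ_ n).inv).op := by
    rw [← Functor.map_comp, ← op_comp, rightUnitor_tensor_inv]
    simp
  rw [component_eq, ← whisker_exchange_assoc]
  simp only [DayFunctor.comp_natTrans, NatTrans.comp_app, Category.assoc]
  rw [reassoc_of% pair_associator, component_eq]
  simp only [NatTrans.naturality_assoc, hk, reassoc_of% pair_whiskerLeft, tensor_whiskerLeft,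
    MonoidalCategory.whiskerLeft_comp, Category.assoc, Iso.inv_hom_id_assoc]
  rw [reassoc_of% pair_naturality_right, NatTrans.naturality]

lemma pair_pair_associator_ext {F G H K L : DayFunctor Mᵒᵖ C} (h : F ⊗ H ⟶ K) (k : G ⊗ K ⟶ L)
    (p n m : M) :
    pair G F p n ▷ H.functor.obj (op m) ≫ pair (G ⊗ F) H (p ⊗ n) m ≫
        ((α_ G F H).hom ≫ G ◁ h ≫ k).natTrans.app (op ((p ⊗ n) ⊗ m)) =
      (α_ _ _ _).hom ≫ G.functor.obj (op p) ◁ pair F H n m ≫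
        G.functor.obj (op p) ◁ h.natTrans.app (op (n ⊗ m)) ≫ pair G K p (n ⊗ m) ≫
          k.natTrans.app (op (p ⊗ (n ⊗ m))) ≫ L.functor.map (α_ p n m).hom.op := by
  simp only [DayFunctor.comp_natTrans, NatTrans.comp_app]
  rw [reassoc_of% pair_associator, NatTrans.naturality_assoc, NatTrans.naturality,
    reassoc_of% pair_whiskerLeft]

lemma dayUnit_component_leftUnitor {X : C} {H : DayFunctor Mᵒᵖ C} (k : (root M C).obj X ⟶ H) :
    dayUnit M C ▷ X ≫ component ((λ_ _).hom ≫ k) (𝟙_ M) =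
      snd _ _ ≫ rootUnit X ≫ k.natTrans.app (op (𝟙_ M)) := by
  have hk : k.natTrans.app (op (𝟙_ M ⊗ 𝟙_ M)) ≫ H.functor.map (ρ_ (𝟙_ M)).inv.op =
      ((root M C).obj X).functor.map (ρ_ (𝟙_ M)).inv.op ≫ k.natTrans.app (op (𝟙_ M)) :=
    (k.natTrans.naturality _).symm
  rw [component_eq, ← whisker_exchange_assoc]
  simp only [DayFunctor.comp_natTrans, NatTrans.comp_app, Category.assoc]
  rw [reassoc_of% pair_leftUnitor, hk, ← Functor.map_comp_assoc, ← op_comp, unitors_equal,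
    Iso.inv_hom_id, op_id, CategoryTheory.Functor.map_id, Category.id_comp,
    leftUnitor_naturality_assoc, leftUnitor_hom]

lemma whiskerLeft_component {F G H : DayFunctor Mᵒᵖ C} {X : C} (k : (root M C).obj X ⟶ G)
    (h : F ⊗ G ⟶ H) (n : M) :
    component (F ◁ k ≫ h) n =
      F.functor.obj (op n) ◁ (rootUnit X ≫ k.natTrans.app (op (𝟙_ M))) ≫ pair F G n (𝟙_ M) ≫
        h.natTrans.app (op (n ⊗ 𝟙_ M)) ≫ H.functor.map (ρ_ n).inv.op := by
  simp only [component_eq, DayFunctor.comp_natTrans, NatTrans.comp_app, Category.assoc,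
    reassoc_of% pair_whiskerLeft, MonoidalCategory.whiskerLeft_comp]

namespace StrongRelativeMonad

variable [SymmetricCategory M] (S : StrongRelativeMonad (root M C).obj)

/-- The strong graded monad induced by a strong relative monad. -/
noncomputable def toGraded : StrongGradedMonad M C where
  obj X := (S.obj X).functor
  unit X := rootUnit X ≫ (S.unit X).natTrans.app (op (𝟙_ M))
  ext m n f := S.gradedExt m n f
  ext_natural_context m n k f := by
    obtain ⟨F, h, c, rfl⟩ := exists_component f
    rw [← comp_whiskerRight_assoc, gradedExt_whiskerRight_component,
      gradedExt_whiskerRight_component, comp_whiskerRight_assoc]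
  ext_natural_right {Γ X Y} m n n' z f := by
    obtain ⟨F, h, c, rfl⟩ := exists_component f
    rw [Category.assoc, ← component_naturality, ← comp_whiskerRight_assoc,
      gradedExt_whiskerRight_component, gradedExt_whiskerRight_component, comp_whiskerRight_assoc,
      reassoc_of% pair_naturality_left, NatTrans.naturality_assoc]
    simp only [Category.assoc, ← Functor.map_comp, ← op_comp,
      BraidedCategory.braiding_naturality_right]
  ext_extranatural_left {Γ X Y} m m' n x f := by
    obtain ⟨F, h, c, rfl⟩ := exists_component f
    rw [gradedExt_whiskerRight_component, gradedExt_whiskerRight_component, whisker_exchange_assoc,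
      reassoc_of% pair_naturality_right, NatTrans.naturality_assoc]
    simp only [Category.assoc, ← Functor.map_comp, ← op_comp,
      BraidedCategory.braiding_naturality_left]
  ext_unit Γ X m := by
    -- The projection is presented by the Day unit, with `Γ ⟶ 1 ⟶ I e` as the map into the context.
    have h : snd Γ X ≫ rootUnit X ≫ (S.unit X).natTrans.app (op (𝟙_ M)) =
        (toUnit Γ ≫ dayUnit M C) ▷ X ≫ component ((λ_ _).hom ≫ S.unit X) (𝟙_ M) := by
      rw [comp_whiskerRight_assoc, dayUnit_component_leftUnitor, whiskerRight_snd_assoc]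
    rw [h, gradedExt_whiskerRight_component, S.ext_unit, comp_whiskerRight_assoc,
      reassoc_of% pair_leftUnitor, leftUnitor_hom, whiskerRight_snd_assoc, ← Functor.map_comp,
      ← op_comp, braiding_leftUnitor]
  unit_ext {Γ X Y} m f := by
    obtain ⟨F, h, c, rfl⟩ := exists_component f
    have key := whiskerLeft_component (S.unit X) (S.ext h) m
    rw [S.unit_ext] at key
    rw [gradedExt_whiskerRight_component, whisker_exchange_assoc, key]
    simp only [Category.assoc, ← Functor.map_comp, ← op_comp]
    rw [← braiding_rightUnitor]
    simp
  ext_ext {Γ X Y Z} l m n f g := by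
    obtain ⟨F, h, c, rfl⟩ := exists_component f
    obtain ⟨G, k, d, rfl⟩ := exists_component g
    -- The Kleisli composite is presented by `G ⊗ F`: the shared context is sent to the pair of `d`
    -- and `c`, which lies in grade `n ⊗ m` and is carried to `m ⊗ n` by the braiding.
    have h₁ : lift (fst Γ X) (c ▷ X ≫ component h m) ≫ S.gradedExt m n (d ▷ Y ≫ component k n) =
        (lift d c ≫ pair G F n m ≫ (G ⊗ F).functor.map (β_ m n).hom.op) ▷ X ≫
          component ((α_ G F _).hom ≫ G ◁ h ≫ S.ext k) (m ⊗ n) := by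
      rw [gradedExt_whiskerRight_component, comp_whiskerRight_assoc, comp_whiskerRight_assoc,
        component_naturality, reassoc_of% pair_component_associator,
        reassoc_of% lift_fst_whiskerRight]
    rw [h₁, gradedExt_whiskerRight_component, gradedExt_whiskerRight_component,
      gradedExt_whiskerRight_component, ← S.ext_ext, reassoc_of% lift_fst_whiskerRight,
      comp_whiskerRight_assoc, comp_whiskerRight_assoc, reassoc_of% pair_naturality_left,
      NatTrans.naturality_assoc, reassoc_of% pair_pair_associator_ext]
    simp only [MonoidalCategory.whiskerLeft_comp, Category.assoc]
    rw [reassoc_of% pair_naturality_right, NatTrans.naturality_assoc]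
    simp only [Category.assoc, ← Functor.map_comp, ← op_comp]
    rw [braiding_tensor_left_whiskerLeft]

end StrongRelativeMonad

/-! ### From graded monads to relative monads -/

/-- The transpose `J X ⟶ H` of a map `X ⟶ H e`. -/
noncomputable def rootTranspose {X : C} {H : DayFunctor Mᵒᵖ C}
    (f : X ⟶ H.functor.obj (op (𝟙_ M))) : (root M C).obj X ⟶ H :=
  ⟨{ app := fun n => rootDesc fun u => f ≫ H.functor.map u.op
     naturality := fun n n' z => root_hom_ext (n := n.unop) fun u => by
      have h₁ := rootUnit_map_rootDesc (fun u => f ≫ H.functor.map u.op) u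
      have h₂ := rootUnit_map_rootDesc (fun u => f ≫ H.functor.map u.op) (z.unop ≫ u)
      rw [op_comp, Functor.map_comp, Functor.map_comp, Category.assoc] at h₂
      simp only [op_unop, Quiver.Hom.op_unop] at h₁ h₂ ⊢
      rw [h₂, reassoc_of% h₁] }⟩

omit [MonoidalClosed C] in
lemma rootUnit_rootTranspose {X : C} {H : DayFunctor Mᵒᵖ C}
    (f : X ⟶ H.functor.obj (op (𝟙_ M))) :
    rootUnit X ≫ (rootTranspose f).natTrans.app (op (𝟙_ M)) = f :=
  (rootUnit_rootDesc _).trans (by rw [op_id, CategoryTheory.Functor.map_id, Category.comp_id])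

omit [MonoidalClosed C] in
lemma root_obj_hom_ext {X : C} {H : DayFunctor Mᵒᵖ C} {f g : (root M C).obj X ⟶ H}
    (h : rootUnit X ≫ f.natTrans.app (op (𝟙_ M)) = rootUnit X ≫ g.natTrans.app (op (𝟙_ M))) :
    f = g := by
  apply DayFunctor.hom_ext
  apply NatTrans.ext
  funext n
  refine root_hom_ext (n := n.unop) fun u => ?_
  have hf := f.natTrans.naturality u.op
  have hg := g.natTrans.naturality u.op
  simp only [op_unop] at hf hg ⊢
  rw [hf, hg, reassoc_of% h]

/-- Through the isomorphism `I ⊗ F ≅ F`, the restriction along `dayUnit` becomes the corresponding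
map out of `F` up to unitors, so nothing is lost. -/
lemma dayUnit_pair_hom_ext {F H : DayFunctor Mᵒᵖ C} {f g : 𝟙_ (DayFunctor Mᵒᵖ C) ⊗ F ⟶ H}
    (h : ∀ m : M,
      dayUnit M C ▷ F.functor.obj (op m) ≫ pair (𝟙_ (DayFunctor Mᵒᵖ C)) F (𝟙_ M) m ≫
          f.natTrans.app (op (𝟙_ M ⊗ m)) =
        dayUnit M C ▷ F.functor.obj (op m) ≫ pair (𝟙_ (DayFunctor Mᵒᵖ C)) F (𝟙_ M) m ≫
          g.natTrans.app (op (𝟙_ M ⊗ m))) : f = g := by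
  rw [← cancel_epi (λ_ F).inv]
  apply DayFunctor.hom_ext
  apply NatTrans.ext
  funext n
  have key (f : 𝟙_ (DayFunctor Mᵒᵖ C) ⊗ F ⟶ H) :
      dayUnit M C ▷ F.functor.obj n ≫ pair (𝟙_ (DayFunctor Mᵒᵖ C)) F (𝟙_ M) n.unop ≫
          f.natTrans.app (op (𝟙_ M ⊗ n.unop)) =
        (λ_ _).hom ≫ ((λ_ F).inv ≫ f).natTrans.app n ≫ H.functor.map (λ_ n.unop).hom.op := by
    rw [← Iso.hom_inv_id_assoc (λ_ F) f]
    have h₁ := reassoc_of% (pair_leftUnitor F n.unop)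
    specialize h₁ (((λ_ F).inv ≫ f).natTrans.app (op (𝟙_ M ⊗ n.unop)))
    have h₂ := ((λ_ F).inv ≫ f).natTrans.naturality (λ_ n.unop).hom.op
    simp only [op_unop] at h₁ h₂
    rw [DayFunctor.comp_natTrans, NatTrans.comp_app, h₁, h₂, Iso.inv_hom_id_assoc]
  have hn := h n.unop
  simp only [op_unop] at hn
  rw [key, key, cancel_epi, cancel_mono] at hn
  exact hn

namespace StrongGradedMonad

variable [SymmetricCategory M] (G : StrongGradedMonad M C)

/-- The extension operators of the strong relative monad induced by a graded monad. -/
noncomputable def relativeExt {F : DayFunctor Mᵒᵖ C} {X Y : C}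
    (h : F ⊗ (root M C).obj X ⟶ ⟨G.obj Y⟩) : F ⊗ ⟨G.obj X⟩ ⟶ ⟨G.obj Y⟩ :=
  pairDesc (fun n m => G.ext m n (component h n) ≫ (G.obj Y).map (β_ m n).inv.op)
    (by
      intro n n' x m
      dsimp only
      rw [← reassoc_of% G.ext_natural_context, component_naturality, G.ext_natural_right]
      simp only [Category.assoc, ← Functor.map_comp, ← op_comp,
        BraidedCategory.braiding_inv_naturality_left])
    (by
      intro n m m' z
      dsimp only
      rw [reassoc_of% G.ext_extranatural_left]
      simp only [Category.assoc, ← Functor.map_comp, ← op_comp,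
        BraidedCategory.braiding_inv_naturality_right])

lemma pair_relativeExt {F : DayFunctor Mᵒᵖ C} {X Y : C}
    (h : F ⊗ (root M C).obj X ⟶ ⟨G.obj Y⟩) (n m : M) :
    pair F ⟨G.obj X⟩ n m ≫ (G.relativeExt h).natTrans.app (op (n ⊗ m)) =
      G.ext m n (component h n) ≫ (G.obj Y).map (β_ m n).inv.op :=
  pair_pairDesc _ _ _ n m

/-- The strong relative monad induced by a strong graded monad. -/
noncomputable def toRelative : StrongRelativeMonad (root M C).obj where
  obj X := ⟨G.obj X⟩
  unit X := rootTranspose (G.unit X)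
  ext h := G.relativeExt h
  ext_natural k f := by
    refine pair_hom_ext fun n m => ?_
    rw [pair_relativeExt, whiskerRight_component, G.ext_natural_context, DayFunctor.comp_natTrans,
      NatTrans.comp_app, reassoc_of% pair_whiskerRight, pair_relativeExt, Category.assoc]
  ext_unit X := by
    refine dayUnit_pair_hom_ext fun m => ?_
    rw [pair_leftUnitor, pair_relativeExt, ← reassoc_of% G.ext_natural_context,
      dayUnit_component_leftUnitor, rootUnit_rootTranspose, G.ext_unit, leftUnitor_hom,
      Category.assoc, ← Functor.map_comp, ← op_comp, ← braiding_leftUnitor]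
    simp
  unit_ext {F X Y} h := by
    refine component_injective fun n => ?_
    rw [whiskerLeft_component, rootUnit_rootTranspose, reassoc_of% pair_relativeExt,
      reassoc_of% G.unit_ext]
    simp only [Category.assoc, ← Functor.map_comp, ← op_comp]
    rw [← braiding_rightUnitor]
    simp
  ext_ext {F E X Y Z} h k := by
    refine pair_pair_hom_ext fun p n m => ?_
    rw [pair_pair_associator_ext, pair_relativeExt, ← reassoc_of% G.ext_natural_context,
      pair_component_associator, pair_relativeExt, ← whiskerLeft_comp_assoc, pair_relativeExt]
    simp only [MonoidalCategory.whiskerLeft_comp, Category.assoc]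
    rw [reassoc_of% pair_naturality_right, NatTrans.naturality_assoc, reassoc_of% pair_relativeExt,
      reassoc_of% G.ext_ext_tensor]
    have hr := G.ext_natural_right m (β_ n p).inv ((α_ _ _ X).hom ≫
      E.functor.obj (op p) ◁ component h n ≫ G.ext n p (component k p))
    simp only [Category.assoc] at hr
    rw [hr]
    simp only [Category.assoc, ← Functor.map_comp, ← op_comp]
    rw [braiding_inv_tensor_left_associator]

end StrongGradedMonad

/-! ### The bijection -/

variable (M C) [SymmetricCategory M]

/-- Strong `J`-relative monads on `[Mᵒᵖ, C]` are equivalent to strong `M`-graded monads on `C`. -/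
noncomputable def strongRelativeMonadEquiv :
    StrongRelativeMonad (root M C).obj ≃ StrongGradedMonad M C where
  toFun S := S.toGraded
  invFun G := G.toRelative
  left_inv S := by
    refine StrongRelativeMonad.eq_of_heq rfl (heq_of_eq ?_) (heq_of_eq ?_)
    · funext X
      exact root_obj_hom_ext (rootUnit_rootTranspose _)
    · funext F X Y h
      refine pair_hom_ext fun n m => ?_
      exact (S.toGraded.pair_relativeExt h n m).trans (S.gradedExt_component_braiding_inv m n h)
  right_inv G := by
    refine StrongGradedMonad.eq_of_heq rfl (heq_of_eq ?_) (heq_of_eq ?_)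
    · funext X
      exact rootUnit_rootTranspose _
    · funext Γ X Y m n f
      -- Naturality in the context reduces the comparison to components, where the braiding cancels
      -- its inverse.
      obtain ⟨F, h, c, rfl⟩ := exists_component (H := ⟨G.obj Y⟩) f
      refine (G.toRelative.gradedExt_whiskerRight_component m n h c).trans ?_
      have h₁ := reassoc_of% (G.pair_relativeExt h n m)
      specialize h₁ ((G.obj Y).map (β_ m n).hom.op)
      rw [← Functor.map_comp, ← op_comp, Iso.hom_inv_id, op_id, CategoryTheory.Functor.map_id,
        Category.comp_id] at h₁
      rw [G.ext_natural_context, ← h₁]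
      rfl

variable {M C}

lemma corresponds_toGraded (S : StrongRelativeMonad (root M C).obj) :
    Corresponds S S.toGraded where
  obj_eq X := rfl
  unit_eq X := by
    simp [StrongRelativeMonad.toGraded]
  ext_eq F X Y h m n := by
    simpa [StrongRelativeMonad.toGraded] using! S.gradedExt_component m n h

end Day

end StrongMonads

theorem mainTheorem2 (M : Type w) [SmallCategory M] [MonoidalCategory M] [SymmetricCategory M]
    (C : Type u) [Category.{v} C] [CartesianMonoidalCategory C] [MonoidalClosed C]
    [HasLimitsOfSize.{w, w} C] [HasColimitsOfSize.{w, w} C] :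
    ∃ Φ : StrongMonads.StrongRelativeMonad (StrongMonads.root M C).obj ≃
        StrongMonads.StrongGradedMonad M C,
      ∀ S : StrongMonads.StrongRelativeMonad (StrongMonads.root M C).obj,
        StrongMonads.Corresponds S (Φ S) := by
  exact ⟨StrongMonads.strongRelativeMonadEquiv M C, StrongMonads.corresponds_toGraded⟩
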